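/- **Theorem 2 (Generalizing formula).** Let $X=(X_1,\dots,X_N)$ be an $N$-dimensional Gaussian random vector with mean vector $\mu=(\mu_i)$ and covariance matrix $C=(C_{ij})$ (possibly singular), and write $\sigma_i^2:=C_{ii}$. Let $n=(n_1,\dots,n_N)$ be nonnegative integers, $|n|=\sum_i n_i$, and let $g:\mathbb{R}^N\to\mathbb{R}$ be of class $C^{|n|}$. Assume that all expectations appearing in the formula below exist, i.e. that the random variables inside them are integrable. Then $$ \mathbb{E}\Big[g(X)\prod_{i=1}^N X_i^{n_i}\Big]=\sum_{\substack{r_i+\sum_{j=1}^N\ell_{ij}=n_i\\ i=1,\dots,N}}\Big[\prod_{i=1}^N\binom{n_i}{r_i,\ell_{i1},\dots,\ell_{iN}}\Big]\Big(\prod_{i=1}^N\mu_i^{r_i}\Big)\sum_{k}\Big(\prod_{i=1}^N H_{\ell_{ii},k_{ii}}\,\sigma_i^{2(\ell_{ii}-k_{ii})}\Big)\Big(\prod_{1\le i<j\le N} G_{\ell_{ij},\ell_{ji},k_{ij}}\,C_{ij}^{\,\ell_{ij}+\ell_{ji}-k_{ij}}\Big)\,\mathbb{E}\big[\partial_1^{a_1}\cdots\partial_N^{a_N}g(X)\big].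 $$ The outer sum is over all families of nonnegative integers $r_i,\ell_{ij}$ ($1\le i,j\le N$) with $r_i+\sum_{j}\ell_{ij}=n_i$ for every $i$. The inner sum is over all symmetric arrays $k=(k_{ij})$ of integers ($k_{ij}=k_{ji}$) with $0\le k_{ii}\le\lfloor\ell_{ii}/2\rfloor$ and $0\le k_{ij}\le\min\{\ell_{ij},\ell_{ji}\}$ for $i\ne j$. Here $\binom{m}{r,\ell_1,\dots,\ell_N}=\frac{m!}{r!\,\ell_1!\cdots\ell_N!}$, $$ H_{\ell,k}=\frac{\ell!}{2^k\,k!\,(\ell-2k)!},\qquad G_{\ell_1,\ell_2,k}=\binom{\ell_1}{k}\binom{\ell_2}{k}k!, $$ and the orders of the partial derivatives are $$ a_i=\sum_{j=1}^N\big[\ell_{ji}-(1+\delta_{ij})k_{ij}\big],\qquad i=1,\dots,N, $$ with $\delta_{ij}$ the Kronecker delta. -/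

import Mathlib

open MeasureTheory ProbabilityTheory

noncomputable section

namespace GaussianFormula

/-- The partial derivative `∂ᵢ f` on `ℝ^N`: the derivative along the `i`-th coordinate vector. -/
def partialDeriv {N : ℕ} (i : Fin N) (f : (Fin N → ℝ) → ℝ) : (Fin N → ℝ) → ℝ :=
  fun x => lineDeriv ℝ f x (Pi.single i 1)

/-- The mixed partial derivative `∂₁^{a₁} ⋯ ∂_N^{a_N} g`. -/
def mixedPartial {N : ℕ} (a : Fin N → ℕ) (g : (Fin N → ℝ) → ℝ) : (Fin N → ℝ) → ℝ :=
  (List.finRange N).foldr (fun i f => (partialDeriv i)^[a i] f) g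

/-- `H_{ℓ,k} = ℓ! / (2^k k! (ℓ-2k)!)`, used for `k ≤ ⌊ℓ/2⌋`. -/
def coeffH (l k : ℕ) : ℝ :=
  (l.factorial : ℝ) / (2 ^ k * (k.factorial : ℝ) * ((l - 2 * k).factorial : ℝ))

/-- `G_{ℓ₁,ℓ₂,k} = C(ℓ₁,k) C(ℓ₂,k) k!`, used for `k ≤ min(ℓ₁,ℓ₂)`. -/
def coeffG (l₁ l₂ k : ℕ) : ℝ :=
  (l₁.choose k : ℝ) * (l₂.choose k : ℝ) * (k.factorial : ℝ)

/-- The multinomial coefficient `n! / (r! ℓ₁! ⋯ ℓ_N!)`. -/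
def multinomialCoeff {N : ℕ} (n r : ℕ) (l : Fin N → ℕ) : ℝ :=
  (n.factorial : ℝ) / ((r.factorial : ℝ) * ∏ j, ((l j).factorial : ℝ))

/-- All families `(r, ℓ)` of nonnegative integers with `rᵢ + ∑ⱼ ℓᵢⱼ = nᵢ` for every `i`
(the ranges only make the set visibly finite). -/
def decompositions {N : ℕ} (n : Fin N → ℕ) :
    Finset ((Fin N → ℕ) × (Fin N → Fin N → ℕ)) :=
  ((Fintype.piFinset fun i => Finset.range (n i + 1)) ×ˢ
    (Fintype.piFinset fun i => Fintype.piFinset fun _ => Finset.range (n i + 1))).filter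
    fun p => ∀ i, p.1 i + ∑ j, p.2 i j = n i

/-- The largest value of `kᵢⱼ`: `⌊ℓᵢᵢ/2⌋` on the diagonal and `min(ℓᵢⱼ, ℓⱼᵢ)` off it. -/
def maxPairing {N : ℕ} (l : Fin N → Fin N → ℕ) (i j : Fin N) : ℕ :=
  if i = j then l i i / 2 else min (l i j) (l j i)

/-- All arrays `k` with `kᵢⱼ = kⱼᵢ`, `0 ≤ kᵢᵢ ≤ ⌊ℓᵢᵢ/2⌋` and `0 ≤ kᵢⱼ ≤ min(ℓᵢⱼ, ℓⱼᵢ)`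
for `i ≠ j`. -/
def pairings {N : ℕ} (l : Fin N → Fin N → ℕ) : Finset (Fin N → Fin N → ℕ) :=
  (Fintype.piFinset fun i => Fintype.piFinset fun j => Finset.range (maxPairing l i j + 1)).filter
    fun k => ∀ i j, k i j = k j i

/-- The orders `aᵢ = ∑ⱼ [ℓⱼᵢ - (1 + δᵢⱼ) kᵢⱼ]`. For `k ∈ pairings ℓ` no subtraction truncates. -/
def derivOrder {N : ℕ} (l k : Fin N → Fin N → ℕ) (i : Fin N) : ℕ :=
  ∑ j, (l j i - (1 + if i = j then 1 else 0) * k i j)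

end GaussianFormula

end

open GaussianFormula

/-!
Stein's identity `E[(Xⱼ - μⱼ) f(X)] = ∑ᵢ Cⱼᵢ E[∂ᵢ f(X)]` holds as soon as `f(X)` and the `∂ᵢ f(X)`
are integrable, integrability of `Xⱼ f(X)` being then automatic: along a direction in which `X`
splits into an independent sum `Y + Z • w` with `Z` a centered real Gaussian of density `φ`,
Tonelli's theorem and `∫_{x > t} x φ(x) dx = σ² φ(t)` give `E|Z (h(Z) - h(0))| ≤ σ² E|h'(Z)|`.

Applied to `f = x ^ b ∂ ^ a g`, it expresses the moments `E[X ^ b ∂ ^ a g(X)]` by those of lower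
degree in `X`, and so determines them from the `E[∂ ^ a g(X)]`. Up to the factor `b!`, the
coefficients of `exp (t·μ + t·C·t / 2 + t·C·D)`, where `D` shifts `a`, satisfy the same recursion by
Euler's identity. The formula is the expansion of this exponential over the monomials `tᵢ μᵢ`,
`tᵢ Cᵢⱼ Dⱼ` and `tᵢ tⱼ Cᵢⱼ` (halved for `i = j`), with multiplicities `rᵢ`,
`ℓᵢⱼ - (1 + δᵢⱼ) kᵢⱼ` and `kᵢⱼ`.
-/

namespace GaussianFormula

open Filter Set
open scoped NNReal ENNReal Topology Interval

section GaussianReal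

variable {v : ℝ≥0}

lemma integrable_gaussianReal_iff (hv : v ≠ 0) {μ : ℝ} {f : ℝ → ℝ} :
    Integrable f (gaussianReal μ v) ↔ Integrable fun x => gaussianPDFReal μ v x * f x := by
  rw [gaussianReal_of_var_ne_zero _ hv, integrable_withDensity_iff_integrable_smul'
    (measurable_gaussianPDF μ v) (ae_of_all _ fun _ => gaussianPDF_lt_top)]
  simp only [toReal_gaussianPDF, smul_eq_mul]

lemma hasDerivAt_gaussianPDFReal (μ : ℝ) (v : ℝ≥0) (x : ℝ) :
    HasDerivAt (gaussianPDFReal μ v) (-((x - μ) / v) * gaussianPDFReal μ v x) x := by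
  have hexponent : HasDerivAt (fun x : ℝ => -(x - μ) ^ 2 / (2 * v)) (-((x - μ) / v)) x := by
    refine ((((hasDerivAt_id x).sub_const μ).pow 2).neg.div_const (2 * (v : ℝ))).congr_deriv ?_
    simp only [id, Nat.cast_ofNat, Nat.add_one_sub_one, pow_one, mul_one, neg_div]
    rw [mul_div_mul_left _ _ two_ne_zero]
  rw [gaussianPDFReal_def]
  exact (hexponent.exp.const_mul _).congr_deriv (by ring)

lemma tendsto_gaussianPDFReal_zero_atTop (hv : v ≠ 0) :
    Tendsto (gaussianPDFReal 0 v) atTop (𝓝 0) := by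
  have hexponent : Tendsto (fun x : ℝ => -(x - 0) ^ 2 / (2 * v)) atTop atBot := by
    have hsq : Tendsto (fun x : ℝ => x ^ 2 / (2 * v)) atTop atTop :=
      (tendsto_pow_atTop two_ne_zero).atTop_div_const (by positivity)
    simpa only [sub_zero, neg_div, Function.comp_def] using tendsto_neg_atTop_atBot.comp hsq
  rw [gaussianPDFReal_def]
  simpa only [mul_zero, Function.comp_def] using
    (Real.tendsto_exp_atBot.comp hexponent).const_mul (√(2 * Real.pi * v))⁻¹

lemma setLIntegral_Ioi_enorm_gaussianReal (hv : v ≠ 0) {t : ℝ} (ht : 0 ≤ t) :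
    ∫⁻ x in Ioi t, ‖x‖ₑ ∂gaussianReal 0 v = v * gaussianPDF 0 v t := by
  have hderiv (x : ℝ) :
      HasDerivAt (fun x => -(v * gaussianPDFReal 0 v x)) (gaussianPDFReal 0 v x * x) x := by
    refine ((hasDerivAt_gaussianPDFReal 0 v x).const_mul (v : ℝ)).neg.congr_deriv ?_
    rw [sub_zero]
    field_simp
  have hnonneg : ∀ x ∈ Ioi t, 0 ≤ gaussianPDFReal 0 v x * x := fun x hx =>
    mul_nonneg (gaussianPDFReal_nonneg 0 v x) (ht.trans (le_of_lt hx))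
  have hlim : Tendsto (fun x => -(v * gaussianPDFReal 0 v x)) atTop (𝓝 0) := by
    simpa using ((tendsto_gaussianPDFReal_zero_atTop hv).const_mul (v : ℝ)).neg
  calc ∫⁻ x in Ioi t, ‖x‖ₑ ∂gaussianReal 0 v
      = ∫⁻ x in Ioi t, gaussianPDF 0 v x * ‖x‖ₑ := by
        rw [gaussianReal_of_var_ne_zero _ hv, setLIntegral_withDensity_eq_setLIntegral_mul _
          (measurable_gaussianPDF 0 v) measurable_enorm measurableSet_Ioi]
        rfl
    _ = ∫⁻ x in Ioi t, ENNReal.ofReal (gaussianPDFReal 0 v x * x) :=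
        setLIntegral_congr_fun measurableSet_Ioi fun x hx => by
          rw [gaussianPDF, Real.enorm_of_nonneg (ht.trans (le_of_lt hx)),
            ENNReal.ofReal_mul (gaussianPDFReal_nonneg 0 v x)]
    _ = ENNReal.ofReal (∫ x in Ioi t, gaussianPDFReal 0 v x * x) :=
        (ofReal_integral_eq_lintegral_ofReal
          (integrableOn_Ioi_deriv_of_nonneg' (fun x _ => hderiv x) hnonneg hlim)
          (ae_restrict_of_forall_mem measurableSet_Ioi hnonneg)).symm
    _ = v * gaussianPDF 0 v t := by
        rw [integral_Ioi_of_hasDerivAt_of_nonneg' (fun x _ => hderiv x) hnonneg hlim, zero_sub,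
          neg_neg, ENNReal.ofReal_mul v.coe_nonneg, ENNReal.ofReal_coe_nnreal, gaussianPDF]

lemma setLIntegral_Iio_enorm_gaussianReal (hv : v ≠ 0) {t : ℝ} (ht : t ≤ 0) :
    ∫⁻ x in Iio t, ‖x‖ₑ ∂gaussianReal 0 v = v * gaussianPDF 0 v t := by
  have hneg : MeasurePreserving (fun x : ℝ => -x) (gaussianReal 0 v) (gaussianReal 0 v) :=
    ⟨measurable_neg, by rw [gaussianReal_map_neg, neg_zero]⟩
  rw [← hneg.setLIntegral_comp_preimage measurableSet_Iio measurable_enorm]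
  have hsymm : gaussianPDF 0 v (-t) = gaussianPDF 0 v t := by
    simp only [gaussianPDF, gaussianPDFReal_def, sub_zero, neg_sq]
  simpa only [enorm_neg, neg_preimage, Set.neg_Iio, hsymm] using
    setLIntegral_Ioi_enorm_gaussianReal hv (neg_nonneg.2 ht)

lemma setLIntegral_mem_uIoc_enorm_gaussianReal (hv : v ≠ 0) (t : ℝ) :
    ∫⁻ x in {x | t ∈ Ι 0 x}, ‖x‖ₑ ∂gaussianReal 0 v = v * gaussianPDF 0 v t := by
  have := nullSingletonClass_gaussianReal (μ := 0) hv
  rcases lt_or_ge 0 t with ht | ht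
  · have hset : {x | t ∈ Ι 0 x} = Ici t := by
      ext x
      simp [mem_uIoc, ht, ht.not_ge]
    rw [hset, setLIntegral_congr Ioi_ae_eq_Ici.symm, setLIntegral_Ioi_enorm_gaussianReal hv ht.le]
  · have hset : {x | t ∈ Ι 0 x} = Iio t := by
      ext x
      simp [mem_uIoc, ht, ht.not_gt]
    rw [hset, setLIntegral_Iio_enorm_gaussianReal hv ht]

lemma enorm_sub_le_setLIntegral_uIoc {h h' : ℝ → ℝ} (hh : ∀ x, HasDerivAt h (h' x) x)
    (hh' : Continuous h') (a b : ℝ) : ‖h b - h a‖ₑ ≤ ∫⁻ t in Ι a b, ‖h' t‖ₑ := by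
  rw [← intervalIntegral.integral_eq_sub_of_hasDerivAt (fun x _ => hh x)
    (hh'.intervalIntegrable a b), enorm_eq_iff_norm_eq.2
    (intervalIntegral.norm_intervalIntegral_eq h' a b volume)]
  exact enorm_integral_le_lintegral_enorm _

-- Write `h x - h 0` as the integral of `h'` from `0` to `x` and integrate in `x` first: the
-- weight of `h' t` is then `∫ |x|` over the Gaussian tail beyond `t`, which is `v φ(t)`.
lemma lintegral_enorm_mul_sub_gaussianReal_le (hv : v ≠ 0) {h h' : ℝ → ℝ}
    (hh : ∀ x, HasDerivAt h (h' x) x) (hh' : Continuous h') :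
    ∫⁻ x, ‖x * (h x - h 0)‖ₑ ∂gaussianReal 0 v ≤ v * ∫⁻ x, ‖h' x‖ₑ ∂gaussianReal 0 v := by
  let between : Set (ℝ × ℝ) := {p | p.2 ∈ Ι 0 p.1}
  let weight : ℝ × ℝ → ℝ≥0∞ := fun p => ‖p.1‖ₑ * ‖h' p.2‖ₑ
  have hbetween : MeasurableSet between := by
    simp only [between, mem_uIoc]
    measurability
  have hweight : Measurable (between.indicator weight) :=
    Measurable.indicator (by fun_prop) hbetween
  calc ∫⁻ x, ‖x * (h x - h 0)‖ₑ ∂gaussianReal 0 v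
      ≤ ∫⁻ x, (‖x‖ₑ * ∫⁻ t in Ι 0 x, ‖h' t‖ₑ) ∂gaussianReal 0 v := by
        simp only [enorm_mul]
        gcongr with x
        exact enorm_sub_le_setLIntegral_uIoc hh hh' 0 x
    _ = ∫⁻ x, (∫⁻ t, between.indicator weight (x, t)) ∂gaussianReal 0 v := by
        refine lintegral_congr fun x => ?_
        rw [← lintegral_const_mul _ (by fun_prop), ← lintegral_indicator measurableSet_uIoc]
        rfl
    _ = ∫⁻ t, ∫⁻ x, between.indicator weight (x, t) ∂gaussianReal 0 v :=
        lintegral_lintegral_swap hweight.aemeasurable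
    _ = ∫⁻ t, v * gaussianPDF 0 v t * ‖h' t‖ₑ := by
        refine lintegral_congr fun t => ?_
        rw [← setLIntegral_mem_uIoc_enorm_gaussianReal hv t,
          ← lintegral_mul_const _ measurable_enorm]
        exact lintegral_indicator (measurable_prodMk_right hbetween) _
    _ = v * ∫⁻ x, ‖h' x‖ₑ ∂gaussianReal 0 v := by
        rw [gaussianReal_of_var_ne_zero _ hv, lintegral_withDensity_eq_lintegral_mul _
          (measurable_gaussianPDF 0 v) (by fun_prop), ← lintegral_const_mul _
          (((measurable_gaussianPDF 0 v).mul (by fun_prop)))]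
        simp only [Pi.mul_apply, mul_assoc]

lemma integral_mul_gaussianReal (hv : v ≠ 0) {h h' : ℝ → ℝ} (hh : ∀ x, HasDerivAt h (h' x) x)
    (hi : Integrable h (gaussianReal 0 v)) (hi' : Integrable h' (gaussianReal 0 v))
    (hxi : Integrable (fun x => x * h x) (gaussianReal 0 v)) :
    ∫ x, x * h x ∂gaussianReal 0 v = v * ∫ x, h' x ∂gaussianReal 0 v := by
  have hv' : (v : ℝ) ≠ 0 := NNReal.coe_ne_zero.2 hv
  rw [integrable_gaussianReal_iff hv] at hxi hi hi'
  simp only [integral_gaussianReal_eq_integral_smul hv, smul_eq_mul]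
  have hparts := integral_mul_deriv_eq_deriv_mul_of_integrable (u := gaussianPDFReal 0 v)
    (fun x _ => hasDerivAt_gaussianPDFReal 0 v x) (fun x _ => hh x) hi'
    ((hxi.const_mul (-(v : ℝ)⁻¹)).congr (ae_of_all _ fun x => by simp; ring)) hi
  have hx (x : ℝ) : -((x - 0) / v) * gaussianPDFReal 0 v x * h x =
      -(v : ℝ)⁻¹ * (gaussianPDFReal 0 v x * (x * h x)) := by
    rw [sub_zero]
    ring
  simp only [hx, integral_const_mul] at hparts
  rw [hparts]
  field_simp

end GaussianReal

section IndependentDirection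

variable {E : Type*} [NormedAddCommGroup E] [NormedSpace ℝ E] {v : ℝ≥0} {f : E → ℝ}

lemma hasDerivAt_comp_add_smul (hf : ContDiff ℝ 1 f) (y w : E) (z : ℝ) :
    HasDerivAt (fun z : ℝ => f (y + z • w)) (fderiv ℝ f (y + z • w) w) z := by
  have hline : HasDerivAt (fun z : ℝ => y + z • w) w z := by
    simpa using ((hasDerivAt_id z).smul_const w).const_add y
  exact (hf.differentiable one_ne_zero).differentiableAt.hasFDerivAt.comp_hasDerivAt z hline

lemma continuous_fderiv_apply_const (hf : ContDiff ℝ 1 f) (w : E) :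
    Continuous fun x => fderiv ℝ f x w :=
  (hf.continuous_fderiv one_ne_zero).clm_apply continuous_const

variable [MeasurableSpace E] [BorelSpace E] {ν : Measure E}

lemma integrable_snd_mul_sub_prod_gaussianReal (hv : v ≠ 0) (hf : ContDiff ℝ 1 f) (w : E)
    (hi' : Integrable (fun p : E × ℝ => fderiv ℝ f (p.1 + p.2 • w) w)
      (ν.prod (gaussianReal 0 v))) :
    Integrable (fun p : E × ℝ => p.2 * (f (p.1 + p.2 • w) - f p.1))
      (ν.prod (gaussianReal 0 v)) := by
  have hfc := hf.continuous
  have hf'c := continuous_fderiv_apply_const hf w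
  have hmeas : Continuous fun p : E × ℝ => p.2 * (f (p.1 + p.2 • w) - f p.1) := by fun_prop
  have hmeas' : Continuous fun p : E × ℝ => fderiv ℝ f (p.1 + p.2 • w) w :=
    hf'c.comp (by fun_prop)
  refine ⟨hmeas.aestronglyMeasurable, ?_⟩
  calc ∫⁻ p : E × ℝ, ‖p.2 * (f (p.1 + p.2 • w) - f p.1)‖ₑ ∂ν.prod (gaussianReal 0 v)
      = ∫⁻ y, ∫⁻ z, ‖z * (f (y + z • w) - f y)‖ₑ ∂gaussianReal 0 v ∂ν :=
        lintegral_prod _ hmeas.enorm.measurable.aemeasurable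
    _ ≤ ∫⁻ y, v * ∫⁻ z, ‖fderiv ℝ f (y + z • w) w‖ₑ ∂gaussianReal 0 v ∂ν :=
        lintegral_mono fun y => by
          simpa using lintegral_enorm_mul_sub_gaussianReal_le hv (hasDerivAt_comp_add_smul hf y w)
            (hf'c.comp (by fun_prop))
    _ = v * ∫⁻ p : E × ℝ, ‖fderiv ℝ f (p.1 + p.2 • w) w‖ₑ ∂ν.prod (gaussianReal 0 v) := by
        rw [lintegral_const_mul' _ _ ENNReal.coe_ne_top,
          lintegral_prod _ hmeas'.enorm.measurable.aemeasurable]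
    _ < ∞ := ENNReal.mul_lt_top ENNReal.coe_lt_top hi'.2

variable [SFinite ν]

lemma integrable_snd_mul_prod_gaussianReal (hv : v ≠ 0) (hf : ContDiff ℝ 1 f) (w : E)
    (hi : Integrable (fun p : E × ℝ => f (p.1 + p.2 • w)) (ν.prod (gaussianReal 0 v)))
    (hi' : Integrable (fun p : E × ℝ => fderiv ℝ f (p.1 + p.2 • w) w)
      (ν.prod (gaussianReal 0 v))) :
    Integrable (fun p : E × ℝ => p.2 * f (p.1 + p.2 • w)) (ν.prod (gaussianReal 0 v)) := by
  have hsub := integrable_snd_mul_sub_prod_gaussianReal hv hf w hi'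
  have hν : Integrable f ν := by
    have := nullSingletonClass_gaussianReal (μ := 0) hv
    have hne : ∀ᵐ z ∂gaussianReal 0 v, z ≠ 0 := by simp [ae_iff]
    obtain ⟨z, hz, hfz, hsubz⟩ := (hne.and (hi.prod_left_ae.and hsub.prod_left_ae)).exists
    refine (hfz.sub (hsubz.const_mul z⁻¹)).congr (ae_of_all _ fun y => ?_)
    simp only [Pi.sub_apply, inv_mul_cancel_left₀ hz, sub_sub_cancel]
  have hid : Integrable (fun z : ℝ => z) (gaussianReal 0 v) := IsGaussian.integrable_id
  refine (hsub.add (hν.mul_prod hid)).congr (ae_of_all _ fun p => ?_)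
  simp only [Pi.add_apply]
  ring

lemma integral_snd_mul_prod_gaussianReal (hv : v ≠ 0) (hf : ContDiff ℝ 1 f) (w : E)
    (hi : Integrable (fun p : E × ℝ => f (p.1 + p.2 • w)) (ν.prod (gaussianReal 0 v)))
    (hi' : Integrable (fun p : E × ℝ => fderiv ℝ f (p.1 + p.2 • w) w)
      (ν.prod (gaussianReal 0 v))) :
    ∫ p : E × ℝ, p.2 * f (p.1 + p.2 • w) ∂ν.prod (gaussianReal 0 v) =
      v * ∫ p : E × ℝ, fderiv ℝ f (p.1 + p.2 • w) w ∂ν.prod (gaussianReal 0 v) := by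
  have hzi := integrable_snd_mul_prod_gaussianReal hv hf w hi hi'
  rw [integral_prod _ hzi, integral_prod _ hi', ← integral_const_mul]
  refine integral_congr_ae ?_
  filter_upwards [hi.prod_right_ae, hi'.prod_right_ae, hzi.prod_right_ae] with y hy hy' hzy
  exact integral_mul_gaussianReal hv (hasDerivAt_comp_add_smul hf y w) hy hy' hzy

theorem stein_of_indepFun {Ω : Type*} [MeasurableSpace Ω] {P : Measure Ω} [IsFiniteMeasure P]
    {Y : Ω → E} {Z : Ω → ℝ} (hY : AEMeasurable Y P) (hZ : HasLaw Z (gaussianReal 0 v) P)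
    (hYZ : IndepFun Y Z P) (hv : v ≠ 0) (hf : ContDiff ℝ 1 f) (w : E)
    (hi : Integrable (fun ω => f (Y ω + Z ω • w)) P)
    (hi' : Integrable (fun ω => fderiv ℝ f (Y ω + Z ω • w) w) P) :
    Integrable (fun ω => Z ω * f (Y ω + Z ω • w)) P ∧
      ∫ ω, Z ω * f (Y ω + Z ω • w) ∂P = v * ∫ ω, fderiv ℝ f (Y ω + Z ω • w) w ∂P := by
  have hpair : AEMeasurable (fun ω => (Y ω, Z ω)) P := hY.prodMk hZ.aemeasurable
  have hlaw : P.map (fun ω => (Y ω, Z ω)) = (P.map Y).prod (gaussianReal 0 v) := by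
    rw [(indepFun_iff_map_prod_eq_prod_map_map hY hZ.aemeasurable).1 hYZ, hZ.map_eq]
  have hfc := hf.continuous
  have hF : Continuous fun p : E × ℝ => f (p.1 + p.2 • w) := by fun_prop
  have hF' : Continuous fun p : E × ℝ => fderiv ℝ f (p.1 + p.2 • w) w :=
    (continuous_fderiv_apply_const hf w).comp (by fun_prop)
  have hZF : Continuous fun p : E × ℝ => p.2 * f (p.1 + p.2 • w) := by fun_prop
  have hpush (G : E × ℝ → ℝ) (hG : Continuous G) :
      Integrable G ((P.map Y).prod (gaussianReal 0 v)) ↔ Integrable (fun ω => G (Y ω, Z ω)) P := by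
    rw [← hlaw]
    exact integrable_map_measure hG.aestronglyMeasurable hpair
  rw [← hpush _ hF] at hi
  rw [← hpush _ hF'] at hi'
  refine ⟨(hpush _ hZF).1 (integrable_snd_mul_prod_gaussianReal hv hf w hi hi'), ?_⟩
  have hparts := integral_snd_mul_prod_gaussianReal hv hf w hi hi'
  rwa [← hlaw, integral_map hpair hZF.aestronglyMeasurable,
    integral_map hpair hF'.aestronglyMeasurable] at hparts

end IndependentDirection

section Stein

variable {E Ω : Type*} [NormedAddCommGroup E] [NormedSpace ℝ E]
  [MeasurableSpace E] [BorelSpace E] [MeasurableSpace Ω]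
  {P : Measure Ω} {X : Ω → E} {L : StrongDual ℝ E} {u : E} {f : E → ℝ}

/-- `u` is the image of the functional `L` under the covariance operator of `X`. -/
def IsCovarianceImage (X : Ω → E) (P : Measure Ω) (L : StrongDual ℝ E) (u : E) : Prop :=
  ∀ M : StrongDual ℝ E, cov[fun ω => L (X ω), fun ω => M (X ω); P] = M u

lemma IsCovarianceImage.apply_nonneg (hu : IsCovarianceImage X P L u)
    (hX : HasGaussianLaw X P) : 0 ≤ L u := by
  rw [← hu L, covariance_self (hX.map_fun L).aemeasurable]
  exact variance_nonneg _ _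

lemma IsCovarianceImage.hasLaw_sub_integral (hu : IsCovarianceImage X P L u)
    (hX : HasGaussianLaw X P) :
    HasLaw (fun ω => L (X ω) - ∫ ω, L (X ω) ∂P) (gaussianReal 0 (L u).toNNReal) P := by
  have hL : HasGaussianLaw (fun ω => L (X ω)) P := hX.map_fun L
  have hlaw : HasLaw (fun ω => L (X ω)) (gaussianReal (∫ ω, L (X ω) ∂P) (L u).toNNReal) P :=
    ⟨hL.aemeasurable, by rw [hL.map_eq_gaussianReal, ← covariance_self hL.aemeasurable, hu]⟩
  simpa only [sub_self] using gaussianReal_sub_const hlaw (∫ ω, L (X ω) ∂P)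

lemma IsCovarianceImage.ae_eq_integral (hu : IsCovarianceImage X P L u) (hX : HasGaussianLaw X P)
    (hLu : L u = 0) : ∀ᵐ ω ∂P, L (X ω) = ∫ ω, L (X ω) ∂P := by
  have := hX.isProbabilityMeasure
  have hL : HasGaussianLaw (fun ω => L (X ω)) P := hX.map_fun L
  exact ae_eq_integral_of_variance_eq_zero hL.memLp_two
    ((covariance_self hL.aemeasurable).symm.trans ((hu L).trans hLu))

lemma IsCovarianceImage.eq_zero (hu : IsCovarianceImage X P L u) (hX : HasGaussianLaw X P)
    (hLu : L u = 0) : u = 0 := by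
  refine SeparatingDual.eq_zero_of_forall_dual_eq_zero (R := ℝ) fun M => ?_
  rw [← hu M]
  refine integral_eq_zero_of_ae ?_
  filter_upwards [hu.ae_eq_integral hX hLu] with ω hω
  rw [hω, sub_self, zero_mul, Pi.zero_apply]

variable [CompleteSpace E] [SecondCountableTopology E]

lemma IsCovarianceImage.indepFun_sub_smul (hu : IsCovarianceImage X P L u) (hX : HasGaussianLaw X P)
    (hLu : L u ≠ 0) :
    IndepFun (fun ω => X ω - L (X ω) • (L u)⁻¹ • u) (fun ω => L (X ω)) P := by
  let R : E →L[ℝ] E := .id ℝ E - L.smulRight ((L u)⁻¹ • u)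
  refine (hX.map_fun (R.prod L)).indepFun_of_covariance_strongDual fun M₁ M₂ => ?_
  have hmem (M : StrongDual ℝ E) : MemLp (fun ω => M (X ω)) 2 P := (hX.map_fun M).memLp_two
  have hM₁ : M₁ ∘ (fun ω => X ω - L (X ω) • (L u)⁻¹ • u) =
      fun ω => M₁ (X ω) - L (X ω) * M₁ ((L u)⁻¹ • u) := by
    ext ω
    simp only [Function.comp_apply, map_sub, map_smul, smul_eq_mul]
  have hM₂ : M₂ ∘ (fun ω => L (X ω)) = fun ω => L (X ω) * M₂ 1 := by
    ext ω
    rw [Function.comp_apply, ← smul_eq_mul, ← map_smul, smul_eq_mul, mul_one]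
  have := hX.isProbabilityMeasure
  change cov[M₁ ∘ (fun ω => X ω - L (X ω) • (L u)⁻¹ • u), M₂ ∘ (fun ω => L (X ω)); P] = 0
  rw [hM₁, hM₂, covariance_mul_const_right,
    covariance_fun_sub_left (hmem M₁) ((hmem L).mul_const _) (hmem L), covariance_mul_const_left,
    covariance_comm, hu, hu, map_smul, smul_eq_mul, mul_comm (L u), mul_assoc, mul_comm (M₁ u),
    inv_mul_cancel_left₀ hLu, sub_self, zero_mul]

theorem IsCovarianceImage.stein_of_ne_zero (hu : IsCovarianceImage X P L u)
    (hX : HasGaussianLaw X P) (hLu : L u ≠ 0) (hf : ContDiff ℝ 1 f)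
    (hi : Integrable (fun ω => f (X ω)) P)
    (hi' : Integrable (fun ω => fderiv ℝ f (X ω) u) P) :
    Integrable (fun ω => (L (X ω) - ∫ ω, L (X ω) ∂P) * f (X ω)) P ∧
      ∫ ω, (L (X ω) - ∫ ω, L (X ω) ∂P) * f (X ω) ∂P = ∫ ω, fderiv ℝ f (X ω) u ∂P := by
  have := hX.isProbabilityMeasure
  have hL : AEMeasurable (fun ω => L (X ω)) P := (hX.map_fun L).aemeasurable
  set m := ∫ ω, L (X ω) ∂P
  set w := (L u)⁻¹ • u with hw
  have hvar : 0 < L u := (hu.apply_nonneg hX).lt_of_ne' hLu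
  have hindep : IndepFun (fun ω => X ω - L (X ω) • w + m • w) (fun ω => L (X ω) - m) P :=
    (hu.indepFun_sub_smul hX hLu).comp (φ := (· + m • w)) (ψ := (· - m))
      (by fun_prop) (by fun_prop)
  have hsplit (ω : Ω) : X ω - L (X ω) • w + m • w + (L (X ω) - m) • w = X ω := by
    rw [sub_smul]
    abel
  have hfderiv (x : E) : fderiv ℝ f x w = (L u)⁻¹ * fderiv ℝ f x u := by
    rw [hw, map_smul, smul_eq_mul]
  have hstein := stein_of_indepFun ((hX.aemeasurable.sub (hL.smul_const w)).add_const (m • w))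
    (hu.hasLaw_sub_integral hX) hindep (Real.toNNReal_pos.2 hvar).ne' hf w
  simp only [Pi.sub_apply, m, hsplit, hfderiv, integral_const_mul, Real.coe_toNNReal _ hvar.le,
    mul_inv_cancel_left₀ hLu] at hstein
  exact hstein hi (hi'.const_mul _)

theorem IsCovarianceImage.stein (hu : IsCovarianceImage X P L u) (hX : HasGaussianLaw X P)
    (hf : ContDiff ℝ 1 f) (hi : Integrable (fun ω => f (X ω)) P)
    (hi' : Integrable (fun ω => fderiv ℝ f (X ω) u) P) :
    Integrable (fun ω => (L (X ω) - ∫ ω, L (X ω) ∂P) * f (X ω)) P ∧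
      ∫ ω, (L (X ω) - ∫ ω, L (X ω) ∂P) * f (X ω) ∂P = ∫ ω, fderiv ℝ f (X ω) u ∂P := by
  by_cases hLu : L u = 0
  · have hzero : (fun ω => (L (X ω) - ∫ ω, L (X ω) ∂P) * f (X ω)) =ᵐ[P] fun _ => 0 := by
      filter_upwards [hu.ae_eq_integral hX hLu] with ω hω
      rw [← hω, sub_self, zero_mul]
    rw [integrable_congr hzero, integral_congr_ae hzero, hu.eq_zero hX hLu]
    exact ⟨integrable_zero _ _ _, by simp only [map_zero, integral_zero]⟩
  · exact hu.stein_of_ne_zero hX hLu hf hi hi'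

end Stein

section MixedPartial

variable {N : ℕ} {f g : (Fin N → ℝ) → ℝ}

lemma partialDeriv_eq_fderiv (hg : Differentiable ℝ g) (i : Fin N) :
    partialDeriv i g = fun x => fderiv ℝ g x (Pi.single i 1) :=
  funext fun x => (hg x).lineDeriv_eq_fderiv

lemma fderiv_apply_eq_sum_partialDeriv (hg : Differentiable ℝ g) (x u : Fin N → ℝ) :
    fderiv ℝ g x u = ∑ i, u i * partialDeriv i g x := by
  conv_lhs => rw [pi_eq_sum_univ' u]
  simp only [map_sum, map_smul, partialDeriv_eq_fderiv hg, smul_eq_mul]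

lemma contDiff_partialDeriv {m : ℕ} (hg : ContDiff ℝ (m + 1 : ℕ) g) (i : Fin N) :
    ContDiff ℝ m (partialDeriv i g) := by
  rw [partialDeriv_eq_fderiv (hg.differentiable (by simp))]
  exact (hg.fderiv_right (m := m) (by norm_cast)).clm_apply contDiff_const

lemma partialDeriv_comm (hg : ContDiff ℝ 2 g) (i j : Fin N) :
    partialDeriv i (partialDeriv j g) = partialDeriv j (partialDeriv i g) := by
  have hd : Differentiable ℝ (fderiv ℝ g) :=
    (hg.fderiv_right (m := 1) (by norm_num)).differentiable one_ne_zero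
  have hsecond (i j : Fin N) : partialDeriv i (partialDeriv j g) =
      fun x => fderiv ℝ (fderiv ℝ g) x (Pi.single i 1) (Pi.single j 1) := by
    rw [partialDeriv_eq_fderiv (hg.differentiable two_ne_zero) j,
      partialDeriv_eq_fderiv (by fun_prop)]
    ext x
    rw [fderiv_clm_apply (hd x) (by fun_prop)]
    simp
  rw [hsecond, hsecond]
  exact funext fun x => (hg.contDiffAt.isSymmSndFDerivAt (by simp)) _ _

lemma contDiff_iterate_partialDeriv {m : ℕ} (i : Fin N) (k : ℕ) (hg : ContDiff ℝ (m + k : ℕ) g) :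
    ContDiff ℝ m ((partialDeriv i)^[k] g) := by
  induction k generalizing g with
  | zero => exact hg
  | succ k ih => exact ih (contDiff_partialDeriv (by rwa [add_assoc]) i)

lemma iterate_partialDeriv_comm (i j : Fin N) (k : ℕ) (hg : ContDiff ℝ (k + 1 : ℕ) g) :
    (partialDeriv j)^[k] (partialDeriv i g) = partialDeriv i ((partialDeriv j)^[k] g) := by
  induction k generalizing g with
  | zero => rfl
  | succ k ih =>
    rw [Function.iterate_succ_apply, Function.iterate_succ_apply,
      partialDeriv_comm (hg.of_le (by norm_cast; lia)), ih (contDiff_partialDeriv hg j)]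

lemma contDiff_foldr_partialDeriv {m : ℕ} (a : Fin N → ℕ) (l : List (Fin N))
    (hg : ContDiff ℝ (m + (l.map a).sum : ℕ) g) :
    ContDiff ℝ m (l.foldr (fun i f => (partialDeriv i)^[a i] f) g) := by
  induction l generalizing m with
  | nil => exact hg
  | cons j l ih =>
    refine contDiff_iterate_partialDeriv j (a j) (ih ?_)
    rwa [List.map_cons, List.sum_cons, ← add_assoc] at hg

lemma foldr_partialDeriv_add_single_of_notMem (a : Fin N → ℕ) {i : Fin N} {l : List (Fin N)}
    (hi : i ∉ l) :
    l.foldr (fun k f => (partialDeriv k)^[(a + Pi.single i 1 : Fin N → ℕ) k] f) g =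
      l.foldr (fun k f => (partialDeriv k)^[a k] f) g := by
  refine List.foldr_ext _ _ _ fun k hk f => ?_
  rw [Pi.add_apply, Pi.single_eq_of_ne (ne_of_mem_of_not_mem hk hi), add_zero]

lemma foldr_partialDeriv_add_single (a : Fin N → ℕ) {i : Fin N} {l : List (Fin N)} (hl : l.Nodup)
    (hi : i ∈ l) (hg : ContDiff ℝ ((l.map a).sum + 1 : ℕ) g) :
    l.foldr (fun k f => (partialDeriv k)^[(a + Pi.single i 1 : Fin N → ℕ) k] f) g =
      partialDeriv i (l.foldr (fun k f => (partialDeriv k)^[a k] f) g) := by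
  induction l with
  | nil => exact absurd hi List.not_mem_nil
  | cons j l ih =>
    rw [List.nodup_cons] at hl
    rw [List.map_cons, List.sum_cons] at hg
    rw [List.foldr_cons, List.foldr_cons]
    rcases eq_or_ne i j with rfl | hij
    · rw [foldr_partialDeriv_add_single_of_notMem a hl.1, Pi.add_apply, Pi.single_eq_same,
        Function.iterate_succ_apply']
    · rw [ih hl.2 (List.mem_of_ne_of_mem hij hi) (hg.of_le (by norm_cast; lia)), Pi.add_apply,
        Pi.single_eq_of_ne hij.symm, add_zero, iterate_partialDeriv_comm]
      exact contDiff_foldr_partialDeriv a l (hg.of_le (by norm_cast; lia))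

lemma contDiff_mixedPartial {m : ℕ} (a : Fin N → ℕ) (hg : ContDiff ℝ (m + ∑ i, a i : ℕ) g) :
    ContDiff ℝ m (mixedPartial a g) :=
  contDiff_foldr_partialDeriv a _ (by rwa [← Fin.sum_univ_def])

lemma mixedPartial_zero : mixedPartial 0 g = g :=
  List.foldr_fixed' (fun _ => rfl) _

lemma mixedPartial_add_single (a : Fin N → ℕ) (i : Fin N)
    (hg : ContDiff ℝ (∑ i, a i + 1 : ℕ) g) :
    mixedPartial (a + Pi.single i 1) g = partialDeriv i (mixedPartial a g) :=
  foldr_partialDeriv_add_single a (List.nodup_finRange N) (List.mem_finRange i)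
    (by rwa [← Fin.sum_univ_def])

lemma hasLineDerivAt_prod_pow (b : Fin N → ℕ) (i : Fin N) (x : Fin N → ℝ) :
    HasLineDerivAt ℝ (fun x : Fin N → ℝ => ∏ k, x k ^ b k)
      (b i * ∏ k, x k ^ (b - Pi.single i 1 : Fin N → ℕ) k) x (Pi.single i 1) := by
  have hcoord (k : Fin N) : HasDerivAt (fun t : ℝ => (x + t • (Pi.single i 1 : Fin N → ℝ)) k ^ b k)
      (b k * x k ^ (b k - 1) * (Pi.single i 1 : Fin N → ℝ) k) 0 := by
    have := (((hasDerivAt_id (0 : ℝ)).mul_const ((Pi.single i 1 : Fin N → ℝ) k)).const_add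
      (x k)).fun_pow (b k)
    simpa using this
  refine (HasDerivAt.fun_finsetProd fun k _ => hcoord k).congr_deriv ?_
  rw [Finset.sum_eq_single_of_mem i (Finset.mem_univ i) fun k _ hk => by
      rw [Pi.single_eq_of_ne hk, mul_zero, smul_zero],
    ← Finset.mul_prod_erase _ _ (Finset.mem_univ i)]
  have herase : ∀ k ∈ Finset.univ.erase i, (x + (0 : ℝ) • (Pi.single i 1 : Fin N → ℝ)) k ^ b k =
      x k ^ (b - Pi.single i 1 : Fin N → ℕ) k := fun k hk => by
    simp [(Finset.mem_erase.1 hk).1]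
  rw [Finset.prod_congr rfl herase, Pi.sub_apply, Pi.single_eq_same, Pi.single_eq_same,
    smul_eq_mul]
  ring

lemma partialDeriv_prod_pow_mul (hf : Differentiable ℝ f) (b : Fin N → ℕ) (i : Fin N)
    (x : Fin N → ℝ) :
    partialDeriv i (fun x => (∏ k, x k ^ b k) * f x) x =
      b i * ((∏ k, x k ^ (b - Pi.single i 1 : Fin N → ℕ) k) * f x) +
        (∏ k, x k ^ b k) * partialDeriv i f x := by
  have hderiv : HasLineDerivAt ℝ f (partialDeriv i f x) x (Pi.single i 1) :=
    (hf x).lineDifferentiableAt.hasLineDerivAt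
  have hprod := HasDerivAt.mul (hasLineDerivAt_prod_pow b i x) hderiv
  simp only [zero_smul, add_zero] at hprod
  rw [← mul_assoc]
  exact HasLineDerivAt.lineDeriv hprod

end MixedPartial

section CoordinateStein

variable {N : ℕ} {Ω : Type*} [MeasurableSpace Ω] {P : Measure Ω} {X : Ω → (Fin N → ℝ)}

lemma isCovarianceImage_proj (hX : HasGaussianLaw X P) (j : Fin N) :
    IsCovarianceImage X P (ContinuousLinearMap.proj j)
      fun i => cov[fun ω => X ω j, fun ω => X ω i; P] := by
  intro M
  have := hX.isProbabilityMeasure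
  have hmem (i : Fin N) : MemLp (fun ω => X ω i) 2 P := (hX.eval i).memLp_two
  have hM (x : Fin N → ℝ) : M x = ∑ i, x i * M (Pi.single i 1) := by
    conv_lhs => rw [pi_eq_sum_univ' x]
    simp only [map_sum, map_smul, smul_eq_mul]
  rw [hM fun i => cov[fun ω => X ω j, fun ω => X ω i; P], funext fun ω => hM (X ω)]
  simp only [ContinuousLinearMap.proj_apply]
  rw [covariance_fun_sum_right (fun i => (hmem i).mul_const _) (hmem j)]
  simp only [covariance_mul_const_right]

theorem integrable_coord_mul_and_integral_coord_mul (hX : HasGaussianLaw X P) (j : Fin N)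
    {f : (Fin N → ℝ) → ℝ} (hf : ContDiff ℝ 1 f) (hi : Integrable (fun ω => f (X ω)) P)
    (hi' : ∀ i, Integrable (fun ω => partialDeriv i f (X ω)) P) :
    Integrable (fun ω => X ω j * f (X ω)) P ∧
      ∫ ω, X ω j * f (X ω) ∂P = (∫ ω, X ω j ∂P) * ∫ ω, f (X ω) ∂P +
        ∑ i, cov[fun ω => X ω j, fun ω => X ω i; P] * ∫ ω, partialDeriv i f (X ω) ∂P := by
  have hsum := fderiv_apply_eq_sum_partialDeriv (hf.differentiable one_ne_zero)
  have hterm (i : Fin N) := (hi' i).const_mul cov[fun ω => X ω j, fun ω => X ω i; P]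
  obtain ⟨hint, heq⟩ := (isCovarianceImage_proj hX j).stein hX hf hi (by
    simpa only [hsum] using integrable_finsetSum _ fun i _ => hterm i)
  have hsplit (ω : Ω) : X ω j * f (X ω) =
      (∫ ω, X ω j ∂P) * f (X ω) + (X ω j - ∫ ω, X ω j ∂P) * f (X ω) := by ring
  simp only [hsplit]
  simp only [hsum, integral_finsetSum _ fun i _ => hterm i, integral_const_mul,
    ContinuousLinearMap.proj_apply] at hint heq
  refine ⟨(hi.const_mul _).add hint, ?_⟩
  rw [integral_add (hi.const_mul _) hint, heq, integral_const_mul]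

end CoordinateStein

open scoped Nat

section MultiIndex

lemma single_one_le_iff {ι : Type*} [DecidableEq ι] {b : ι → ℕ} {j : ι} :
    Pi.single j 1 ≤ b ↔ b j ≠ 0 := by
  rw [Pi.single, update_le_iff]
  simp [Nat.one_le_iff_ne_zero]

lemma sub_single_add_single {ι : Type*} [DecidableEq ι] {b : ι → ℕ} {j : ι} (hj : b j ≠ 0) :
    b - Pi.single j 1 + Pi.single j 1 = b :=
  tsub_add_cancel_of_le (single_one_le_iff.2 hj)

variable {ι : Type*} [Fintype ι] [DecidableEq ι]

lemma sum_add_single (b : ι → ℕ) (j : ι) :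
    ∑ k, (b + Pi.single j 1 : ι → ℕ) k = ∑ k, b k + 1 := by
  simp [Finset.sum_add_distrib]

lemma sum_sub_single_le (b : ι → ℕ) (j : ι) :
    ∑ k, (b - Pi.single j 1 : ι → ℕ) k ≤ ∑ k, b k :=
  Finset.sum_le_sum fun _ _ => Nat.sub_le _ _

lemma prod_add_single {M : Type*} [CommMonoid M] {F : ι → ℕ → M} {b : ι → ℕ} {j : ι} {r : M}
    (h : F j (b j + 1) = F j (b j) * r) :
    ∏ k, F k ((b + Pi.single j 1 : ι → ℕ) k) = (∏ k, F k (b k)) * r := by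
  rw [← Finset.mul_prod_erase _ _ (Finset.mem_univ j),
    ← Finset.mul_prod_erase _ (fun k => F k (b k)) (Finset.mem_univ j), Pi.add_apply,
    Pi.single_eq_same, h, mul_right_comm]
  congr 2
  refine Finset.prod_congr rfl fun k hk => ?_
  rw [Pi.add_apply, Pi.single_eq_of_ne (Finset.ne_of_mem_erase hk), add_zero]

lemma prod_pow_add_single {M : Type*} [CommMonoid M] (x : ι → M) (b : ι → ℕ) (j : ι) :
    ∏ k, x k ^ (b + Pi.single j 1 : ι → ℕ) k = (∏ k, x k ^ b k) * x j :=
  prod_add_single (F := fun k e => x k ^ e) (pow_succ _ _)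

lemma prod_factorial_add_single (b : ι → ℕ) (j : ι) :
    ∏ k, ((b + Pi.single j 1 : ι → ℕ) k)! = (∏ k, (b k)!) * (b j + 1) :=
  prod_add_single (F := fun _ e => e !) (by rw [Nat.factorial_succ, mul_comm])

lemma mul_prod_factorial_sub_single {b : ι → ℕ} {i : ι} (hi : b i ≠ 0) :
    b i * ∏ k, ((b - Pi.single i 1 : ι → ℕ) k)! = ∏ k, (b k)! := by
  have h := prod_factorial_add_single (b - Pi.single i 1) i
  rw [sub_single_add_single hi, Pi.sub_apply, Pi.single_eq_same,
    Nat.sub_add_cancel (Nat.one_le_iff_ne_zero.2 hi)] at h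
  rw [h, mul_comm]

theorem multiIndex_induction {p : (ι → ℕ) → Prop} (zero : p 0)
    (add_single : ∀ (b : ι → ℕ) (j : ι), (∀ b' : ι → ℕ, ∑ k, b' k ≤ ∑ k, b k → p b') →
      p (b + Pi.single j 1))
    (b : ι → ℕ) : p b := by
  induction hs : ∑ k, b k using Nat.strong_induction_on generalizing b with
  | _ s ih =>
    obtain rfl | hb := eq_or_ne b 0
    · exact zero
    obtain ⟨j, hj⟩ := Function.ne_iff.1 hb
    have hsum := sum_add_single (b - Pi.single j 1) j
    rw [sub_single_add_single hj] at hsum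
    rw [← sub_single_add_single hj]
    exact add_single _ j fun b' hb' => ih _ (by lia) b' rfl

theorem exists_matrix_of_sum_le {ι κ : Type*} [Fintype ι] [Fintype κ] {n : κ → ℕ} {a : ι → ℕ}
    (ha : ∑ j, a j ≤ ∑ i, n i) :
    ∃ l : κ → ι → ℕ, (∀ i, ∑ j, l i j ≤ n i) ∧ ∀ j, ∑ i, l i j = a j := by
  classical
  induction a using multiIndex_induction with
  | zero => exact ⟨0, by simp, by simp⟩
  | add_single a j ih =>
    rw [sum_add_single] at ha
    obtain ⟨l, hrow, hcol⟩ := ih a le_rfl (by lia)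
    have htotal : ∑ i, ∑ k, l i k = ∑ k, a k := by
      rw [Finset.sum_comm]
      exact Finset.sum_congr rfl fun k _ => hcol k
    obtain ⟨i, -, hi⟩ : ∃ i ∈ Finset.univ, ∑ k, l i k < n i :=
      Finset.exists_lt_of_sum_lt (by lia)
    refine ⟨l + Pi.single i (Pi.single j 1), fun i' => ?_, fun j' => ?_⟩
    · rcases eq_or_ne i' i with rfl | hne
      · rw [Pi.add_apply, Pi.single_eq_same, sum_add_single]
        exact hi
      · simpa [Pi.single_eq_of_ne hne] using hrow i'
    · have hsingle : ∑ x, (Pi.single i (Pi.single j 1) : κ → ι → ℕ) x j' =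
          (Pi.single j 1 : ι → ℕ) j' := by
        rw [← Finset.sum_apply, Finset.sum_pi_single', if_pos (Finset.mem_univ i)]
      simp only [Pi.add_apply, Finset.sum_add_distrib, hsingle, hcol]

end MultiIndex

section SteinRecursion

variable {ι R : Type*} [Fintype ι] [DecidableEq ι] [Semiring R] {μ : ι → R} {C : ι → ι → R}
  {K : ℕ} {I J : (ι → ℕ) → (ι → ℕ) → R}

/-- The recursion in `b` which Stein's identity yields for the moments `I b a = E[X ^ b ∂ ^ a g(X)]`
of a Gaussian vector with mean `μ` and covariance `C`, for orders `|b| + |a| ≤ K`. The truncated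
subtraction `b - eᵢ` is harmless because of the factor `b i`. -/
def SteinRecursion (μ : ι → R) (C : ι → ι → R) (K : ℕ) (I : (ι → ℕ) → (ι → ℕ) → R) : Prop :=
  ∀ (b a : ι → ℕ) (j : ι), ∑ k, b k + ∑ k, a k < K →
    I (b + Pi.single j 1) a = μ j * I b a +
      ∑ i, C j i * (b i * I (b - Pi.single i 1) a + I b (a + Pi.single i 1))

theorem SteinRecursion.eq (hI : SteinRecursion μ C K I) (hJ : SteinRecursion μ C K J)
    (h0 : ∀ a, ∑ k, a k ≤ K → I 0 a = J 0 a) (b a : ι → ℕ) (hK : ∑ k, b k + ∑ k, a k ≤ K) :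
    I b a = J b a := by
  induction b using multiIndex_induction generalizing a with
  | zero => exact h0 a (by simpa using hK)
  | add_single b j ih =>
    rw [sum_add_single] at hK
    have hderiv (i : ι) : I b (a + Pi.single i 1) = J b (a + Pi.single i 1) :=
      ih b le_rfl _ (by rw [sum_add_single]; lia)
    have hlower (i : ι) : I (b - Pi.single i 1) a = J (b - Pi.single i 1) a :=
      ih _ (sum_sub_single_le b i) _ (by have := sum_sub_single_le b i; lia)
    rw [hI b a j (by lia), hJ b a j (by lia), ih b le_rfl a (by lia)]
    simp only [hderiv, hlower]

end SteinRecursion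

section GaussianMoments

variable {N : ℕ} {Ω : Type*} [MeasurableSpace Ω] {P : Measure Ω} {X : Ω → (Fin N → ℝ)}
  {g : (Fin N → ℝ) → ℝ} {K : ℕ}

theorem integrable_and_integral_prod_pow_add_single_mul_mixedPartial (hX : HasGaussianLaw X P)
    {b a : Fin N → ℕ} (hg : ContDiff ℝ (∑ i, a i + 1 : ℕ) g) (j : Fin N)
    (hi : Integrable (fun ω => (∏ k, X ω k ^ b k) * mixedPartial a g (X ω)) P)
    (hlower : ∀ i, Integrable
      (fun ω => (∏ k, X ω k ^ (b - Pi.single i 1 : Fin N → ℕ) k) * mixedPartial a g (X ω)) P)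
    (hderiv : ∀ i, Integrable
      (fun ω => (∏ k, X ω k ^ b k) * mixedPartial (a + Pi.single i 1) g (X ω)) P) :
    Integrable (fun ω => (∏ k, X ω k ^ (b + Pi.single j 1 : Fin N → ℕ) k) *
        mixedPartial a g (X ω)) P ∧
      ∫ ω, (∏ k, X ω k ^ (b + Pi.single j 1 : Fin N → ℕ) k) * mixedPartial a g (X ω) ∂P =
        (∫ ω, X ω j ∂P) * ∫ ω, (∏ k, X ω k ^ b k) * mixedPartial a g (X ω) ∂P +
        ∑ i, cov[fun ω => X ω j, fun ω => X ω i; P] *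
          (b i * ∫ ω, (∏ k, X ω k ^ (b - Pi.single i 1 : Fin N → ℕ) k) *
              mixedPartial a g (X ω) ∂P +
            ∫ ω, (∏ k, X ω k ^ b k) * mixedPartial (a + Pi.single i 1) g (X ω) ∂P) := by
  have hF : ContDiff ℝ 1 (mixedPartial a g) := by
    exact_mod_cast contDiff_mixedPartial (m := 1) a (by rwa [add_comm])
  have hf : ContDiff ℝ 1 fun x : Fin N → ℝ => (∏ k, x k ^ b k) * mixedPartial a g x :=
    (contDiff_prod fun k _ => (contDiff_apply ℝ ℝ k).pow _).mul hF
  have hpartial (i : Fin N) (x : Fin N → ℝ) :=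
    partialDeriv_prod_pow_mul (hF.differentiable one_ne_zero) b i x
  simp only [← mixedPartial_add_single a _ hg] at hpartial
  have hstep (ω : Ω) : (∏ k, X ω k ^ (b + Pi.single j 1 : Fin N → ℕ) k) * mixedPartial a g (X ω) =
      X ω j * ((∏ k, X ω k ^ b k) * mixedPartial a g (X ω)) := by
    rw [prod_pow_add_single, mul_comm (∏ k, _), mul_assoc]
  have hstein := integrable_coord_mul_and_integral_coord_mul hX j hf hi fun i => by
    simp only [hpartial]
    exact ((hlower i).const_mul _).add (hderiv i)
  simpa only [hstep, hpartial, integral_add ((hlower _).const_mul _) (hderiv _),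
    integral_const_mul] using hstein

lemma integrable_prod_pow_mul_mixedPartial (hX : HasGaussianLaw X P) (hg : ContDiff ℝ K g)
    (hint : ∀ a : Fin N → ℕ, ∑ i, a i ≤ K → Integrable (fun ω => mixedPartial a g (X ω)) P)
    (b a : Fin N → ℕ) (hK : ∑ i, b i + ∑ i, a i ≤ K) :
    Integrable (fun ω => (∏ k, X ω k ^ b k) * mixedPartial a g (X ω)) P := by
  induction b using multiIndex_induction generalizing a with
  | zero => simpa using hint a (by simpa using hK)
  | add_single b j ih =>
    rw [sum_add_single] at hK
    refine (integrable_and_integral_prod_pow_add_single_mul_mixedPartial hX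
      (hg.of_le (by norm_cast; lia)) j (ih b le_rfl a (by lia)) (fun i => ?_) fun i => ?_).1
    · have hle := sum_sub_single_le b i
      exact ih _ hle a (by lia)
    · exact ih b le_rfl _ (by rw [sum_add_single]; lia)

theorem steinRecursion_integral (hX : HasGaussianLaw X P) (hg : ContDiff ℝ K g)
    (hint : ∀ a : Fin N → ℕ, ∑ i, a i ≤ K → Integrable (fun ω => mixedPartial a g (X ω)) P) :
    SteinRecursion (fun i => ∫ ω, X ω i ∂P)
      (fun i j => cov[fun ω => X ω i, fun ω => X ω j; P]) K
      fun b a => ∫ ω, (∏ k, X ω k ^ b k) * mixedPartial a g (X ω) ∂P := by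
  intro b a j hK
  have hmoment := integrable_prod_pow_mul_mixedPartial hX hg hint
  refine (integrable_and_integral_prod_pow_add_single_mul_mixedPartial hX
    (hg.of_le (by norm_cast; lia)) j (hmoment b a hK.le) (fun i => ?_) fun i => ?_).2
  · have hle := sum_sub_single_le b i
    exact hmoment _ a (by lia)
  · exact hmoment b _ (by rw [sum_add_single]; lia)

end GaussianMoments

section ExponentialCoeff

variable {ι κ R : Type*} [Fintype ι] [Fintype κ] [Field R]

lemma le_sum_of_sum_smul_eq {d : κ → ι → ℕ} (hd : ∀ α, d α ≠ 0) {m : κ → ℕ}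
    {n : ι → ℕ} (h : ∑ α, m α • d α = n) (α : κ) : m α ≤ ∑ i, n i := by
  obtain ⟨i, hi⟩ := Function.ne_iff.1 (hd α)
  calc m α ≤ m α * d α i := Nat.le_mul_of_pos_right _ (Nat.pos_of_ne_zero hi)
    _ ≤ ∑ β, m β * d β i :=
        Finset.single_le_sum_of_canonicallyOrdered (f := fun β => m β * d β i) (Finset.mem_univ α)
    _ = n i := by simp [← h]
    _ ≤ ∑ i, n i := Finset.single_le_sum_of_canonicallyOrdered (Finset.mem_univ i)

variable [DecidableEq κ]

/-- The finite set of multiplicities `m` with `∑ α, m α • d α = n`, for blocks `α` of degree `d α`.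
The bound `m α ≤ ∑ i, n i` loses nothing when all degrees are nonzero. -/
def weightedMultiplicities (d : κ → ι → ℕ) (n : ι → ℕ) : Finset (κ → ℕ) :=
  {m ∈ Fintype.piFinset fun _ => Finset.range (∑ i, n i + 1) | ∑ α, m α • d α = n}

/-- The product of divided powers `∏ α, c α ^ m α / (m α)!`. -/
def dividedMonomial (c : κ → R) (m : κ → ℕ) : R :=
  ∏ α, c α ^ m α / (m α)!

/-- The coefficient of `t ^ n` in `exp (∑ α, c α * t ^ d α * D ^ o α)` applied to the array `E` and
evaluated at `a`, where `D ^ o` is the shift `E ↦ E (· + o)`. -/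
def exponentialCoeff (d o : κ → ι → ℕ) (c : κ → R) (E : (ι → ℕ) → R) (n a : ι → ℕ) : R :=
  ∑ m ∈ weightedMultiplicities d n, dividedMonomial c m * E (a + ∑ α, m α • o α)

variable {d o : κ → ι → ℕ} {c : κ → R} {E : (ι → ℕ) → R}

lemma mem_weightedMultiplicities (hd : ∀ α, d α ≠ 0) {m : κ → ℕ} {n : ι → ℕ} :
    m ∈ weightedMultiplicities d n ↔ ∑ α, m α • d α = n := by
  simp only [weightedMultiplicities, Finset.mem_filter, Fintype.mem_piFinset, Finset.mem_range,
    and_iff_right_iff_imp]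
  exact fun h α => Nat.lt_succ_of_le (le_sum_of_sum_smul_eq hd h α)

lemma weightedMultiplicities_zero (hd : ∀ α, d α ≠ 0) : weightedMultiplicities d 0 = {0} := by
  ext m
  rw [mem_weightedMultiplicities hd, Finset.mem_singleton]
  refine ⟨fun h => funext fun α => ?_, by rintro rfl; simp⟩
  simpa using le_sum_of_sum_smul_eq hd h α

lemma exponentialCoeff_zero (hd : ∀ α, d α ≠ 0) (a : ι → ℕ) :
    exponentialCoeff d o c E 0 a = E a := by
  simp [exponentialCoeff, weightedMultiplicities_zero hd, dividedMonomial]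

lemma sum_add_single_smul {M : Type*} [AddCommMonoid M] (v : κ → M) (m : κ → ℕ) (α : κ) :
    ∑ β, (m + Pi.single α 1 : κ → ℕ) β • v β = ∑ β, m β • v β + v α := by
  simp [add_smul, Finset.sum_add_distrib, Pi.single_apply, ite_smul]

lemma dividedMonomial_add_single [CharZero R] (c : κ → R) (m : κ → ℕ) (α : κ) :
    (m α + 1 : ℕ) * dividedMonomial c (m + Pi.single α 1) = c α * dividedMonomial c m := by
  have hpos : ((m α + 1 : ℕ) : R) ≠ 0 := Nat.cast_ne_zero.2 (Nat.succ_ne_zero _)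
  have hfact : ((m α)! : R) ≠ 0 := Nat.cast_ne_zero.2 (Nat.factorial_ne_zero _)
  have hstep : c α ^ (m α + 1) / (m α + 1)! =
      c α ^ m α / (m α)! * (c α / (m α + 1 : ℕ)) := by
    rw [Nat.factorial_succ, Nat.cast_mul, pow_succ]
    field_simp
  rw [dividedMonomial, prod_add_single (F := fun β e => c β ^ e / (e ! : R)) hstep,
    ← dividedMonomial]
  field_simp

variable [DecidableLE (ι → ℕ)]

lemma sum_weightedMultiplicities_eq_ite {M : Type*} [AddCommMonoid M] (hd : ∀ α, d α ≠ 0)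
    (n : ι → ℕ) (α : κ) {F : (κ → ℕ) → M} (hF : ∀ m, m α = 0 → F m = 0) :
    ∑ m ∈ weightedMultiplicities d n, F m =
      if d α ≤ n then ∑ m ∈ weightedMultiplicities d (n - d α), F (m + Pi.single α 1) else 0 := by
  have hlower {m : κ → ℕ} (hm : m ∈ weightedMultiplicities d n) (hα : m α ≠ 0) :
      ∑ β, (m - Pi.single α 1 : κ → ℕ) β • d β + d α = n := by
    rw [← sum_add_single_smul, sub_single_add_single hα]
    exact (mem_weightedMultiplicities hd).1 hm
  split_ifs with hle
  · symm
    refine Finset.sum_of_injOn (fun m => m + Pi.single α 1) (add_left_injective _).injOn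
      (fun m hm => ?_) (fun m hm hrange => hF m (by_contra fun hα => hrange ?_)) fun _ _ => rfl
    · rw [Finset.mem_coe, mem_weightedMultiplicities hd] at hm ⊢
      rw [sum_add_single_smul, hm, tsub_add_cancel_of_le hle]
    · refine ⟨m - Pi.single α 1, ?_, sub_single_add_single hα⟩
      rw [Finset.mem_coe, mem_weightedMultiplicities hd, ← hlower hm hα, add_tsub_cancel_right]
  · exact Finset.sum_eq_zero fun m hm =>
      hF m (by_contra fun hα => hle (hlower hm hα ▸ le_add_self))

lemma sum_mul_dividedMonomial [CharZero R] (hd : ∀ α, d α ≠ 0) (n a : ι → ℕ) (α : κ) :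
    ∑ m ∈ weightedMultiplicities d n, m α * (dividedMonomial c m * E (a + ∑ β, m β • o β)) =
      if d α ≤ n then c α * exponentialCoeff d o c E (n - d α) (a + o α) else 0 := by
  rw [sum_weightedMultiplicities_eq_ite hd n α fun m hα => by rw [hα, Nat.cast_zero, zero_mul],
    exponentialCoeff, Finset.mul_sum]
  congr 1
  refine Finset.sum_congr rfl fun m _ => ?_
  rw [Pi.add_apply, Pi.single_eq_same, ← mul_assoc, dividedMonomial_add_single,
    sum_add_single_smul, ← add_assoc, add_right_comm, mul_assoc]

-- Euler's identity `t_j ∂_j exp f = (t_j ∂_j f) exp f`, read off coefficientwise.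
theorem mul_exponentialCoeff [CharZero R] (hd : ∀ α, d α ≠ 0) (n a : ι → ℕ) (j : ι) :
    n j * exponentialCoeff d o c E n a = ∑ α, d α j *
      (if d α ≤ n then c α * exponentialCoeff d o c E (n - d α) (a + o α) else 0) := by
  simp only [← sum_mul_dividedMonomial hd, Finset.mul_sum]
  rw [Finset.sum_comm, exponentialCoeff, Finset.mul_sum]
  refine Finset.sum_congr rfl fun m hm => ?_
  have hn : (n j : R) = ∑ α, (d α j : R) * m α := by
    simp [← (mem_weightedMultiplicities hd).1 hm, mul_comm]
  rw [hn, Finset.sum_mul]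
  simp only [mul_assoc]

end ExponentialCoeff

section GaussianBlocks

lemma sum_sym2_eq_sum_mk {ι M : Type*} [Fintype ι] [AddCommMonoid M] (j : ι)
    {F : Sym2 ι → M} (hF : ∀ s, j ∉ s → F s = 0) : ∑ s, F s = ∑ i, F s(j, i) := by
  symm
  exact Finset.sum_of_injOn (fun i => s(j, i)) (fun _ _ _ _ => Sym2.congr_right.1) (by simp)
    (fun s _ hs => hF s fun ⟨i, hi⟩ => hs ⟨i, by simp, hi.symm⟩) fun _ _ => rfl

variable {ι R : Type*} [DecidableEq ι] [Field R]

/-- The ways of removing factors `Xᵢ` from a Gaussian moment: `inl i` replaces `Xᵢ` by its mean,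
`inr (inl (i, j))` turns `Xᵢ` into the derivative `∂ⱼ`, `inr (inr s(i, j))` contracts `Xᵢ` with
`Xⱼ`. -/
abbrev BlockIndex (ι : Type*) : Type _ := ι ⊕ (ι × ι) ⊕ Sym2 ι

/-- The multidegree `eᵢ + eⱼ` of the contraction `s(i, j)`. -/
def pairDegree : Sym2 ι → ι → ℕ :=
  Sym2.lift ⟨fun i j => Pi.single i 1 + Pi.single j 1, fun _ _ => add_comm _ _⟩

/-- The weight of the contraction `s(i, j)` in the quadratic form `t·C·t / 2`, the symmetric matrix
`C` being given as a function `c` on unordered pairs. -/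
def pairWeight (c : Sym2 ι → R) (s : Sym2 ι) : R :=
  if s.IsDiag then c s / 2 else c s

/-- The multidegree, in the factors `Xᵢ`, of a block. -/
def blockDegree : BlockIndex ι → ι → ℕ
  | .inl i => Pi.single i 1
  | .inr (.inl p) => Pi.single p.1 1
  | .inr (.inr s) => pairDegree s

/-- The multi-index of the derivative which a block produces. -/
def blockShift : BlockIndex ι → ι → ℕ
  | .inr (.inl p) => Pi.single p.2 1
  | _ => 0

/-- The weight of a block, for mean `μ` and covariance `c`. -/
def blockWeight (μ : ι → R) (c : Sym2 ι → R) : BlockIndex ι → R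
  | .inl i => μ i
  | .inr (.inl p) => c s(p.1, p.2)
  | .inr (.inr s) => pairWeight c s

lemma pairDegree_mk (i j : ι) : pairDegree s(i, j) = Pi.single i 1 + Pi.single j 1 := rfl

lemma pairDegree_of_notMem {s : Sym2 ι} {j : ι} (hj : j ∉ s) : pairDegree s j = 0 := by
  induction s using Sym2.ind with
  | _ i k =>
    rw [Sym2.mem_iff, not_or] at hj
    simp [pairDegree_mk, hj.1, hj.2]

lemma blockDegree_ne_zero : ∀ α : BlockIndex ι, blockDegree α ≠ 0
  | .inl i => by simp [blockDegree]
  | .inr (.inl p) => by simp [blockDegree]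
  | .inr (.inr s) => s.ind fun i j h => by
      simpa [blockDegree, pairDegree_mk] using congrFun h i

lemma pairDegree_mul_pairWeight [CharZero R] (c : Sym2 ι → R) (j i : ι) :
    pairDegree s(j, i) j * pairWeight c s(j, i) = c s(j, i) := by
  rw [pairWeight, pairDegree_mk]
  rcases eq_or_ne j i with rfl | hij
  · simp; ring
  · simp [hij]

variable [Fintype ι]

/-- The coefficient of `t ^ n` in `exp (t·μ + t·C·t / 2 + t·C·D)` applied to the array `E` and
evaluated at `a`, where `Dᵢ` shifts `E` by `eᵢ`. For `E a = E[∂ ^ a g(X)]` this is the generating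
function `E[exp (t·X) g(X)] = exp (t·μ + t·C·t / 2) E[g(X + C·t)]`. -/
def gaussianCoeff (μ : ι → R) (c : Sym2 ι → R) (E : (ι → ℕ) → R) (n a : ι → ℕ) : R :=
  exponentialCoeff blockDegree blockShift (blockWeight μ c) E n a

variable [CharZero R] (μ : ι → R) (c : Sym2 ι → R) (E : (ι → ℕ) → R)

lemma sum_pairDegree_mul_gaussianCoeff (n a : ι → ℕ) (j : ι) [DecidableLE (ι → ℕ)] :
    ∑ s : Sym2 ι, pairDegree s j * (if pairDegree s ≤ n + Pi.single j 1 then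
      pairWeight c s * gaussianCoeff μ c E (n + Pi.single j 1 - pairDegree s) a else 0) =
      ∑ i, c s(j, i) * (if n i ≠ 0 then gaussianCoeff μ c E (n - Pi.single i 1) a else 0) := by
  rw [sum_sym2_eq_sum_mk j (fun s hs => by rw [pairDegree_of_notMem hs, Nat.cast_zero, zero_mul])]
  refine Finset.sum_congr rfl fun i _ => ?_
  have hle : pairDegree s(j, i) ≤ n + Pi.single j 1 ↔ n i ≠ 0 := by
    rw [pairDegree_mk, add_comm n, add_le_add_iff_left, single_one_le_iff]
  have hsub : n + Pi.single j 1 - pairDegree s(j, i) = n - Pi.single i 1 := by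
    rw [pairDegree_mk, add_comm n, add_tsub_add_eq_tsub_left]
  simp only [hle, hsub, ← pairDegree_mul_pairWeight c j i]
  split_ifs
  · rw [mul_assoc]
  · rw [mul_zero, mul_zero]

theorem succ_mul_gaussianCoeff (n a : ι → ℕ) (j : ι) :
    (n j + 1 : ℕ) * gaussianCoeff μ c E (n + Pi.single j 1) a =
      μ j * gaussianCoeff μ c E n a +
      ∑ i, c s(j, i) * gaussianCoeff μ c E n (a + Pi.single i 1) +
      ∑ i, c s(j, i) * (if n i ≠ 0 then gaussianCoeff μ c E (n - Pi.single i 1) a else 0) := by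
  classical
  have hle : (Pi.single j 1 : ι → ℕ) ≤ n + Pi.single j 1 := le_add_self
  have heuler : ((n + Pi.single j 1 : ι → ℕ) j : R) * gaussianCoeff μ c E (n + Pi.single j 1) a =
      ∑ α, blockDegree α j * (if blockDegree α ≤ n + Pi.single j 1 then blockWeight μ c α *
        gaussianCoeff μ c E (n + Pi.single j 1 - blockDegree α) (a + blockShift α) else 0) :=
    mul_exponentialCoeff blockDegree_ne_zero (n + Pi.single j 1) a j
  rw [Pi.add_apply, Pi.single_eq_same] at heuler
  rw [heuler, Fintype.sum_sum_type, Fintype.sum_sum_type, ← add_assoc]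
  simp only [blockDegree, blockShift, blockWeight, add_zero]
  rw [sum_pairDegree_mul_gaussianCoeff, Fintype.sum_prod_type]
  congr 2
  · rw [Fintype.sum_eq_single j (fun i hi => by simp [Pi.single_eq_of_ne hi.symm])]
    simp [hle]
  · rw [Fintype.sum_eq_single j (fun i hi => by simp [Pi.single_eq_of_ne hi.symm])]
    simp [hle]

theorem steinRecursion_gaussianCoeff (K : ℕ) :
    SteinRecursion μ (fun i j => c s(i, j)) K fun b a =>
      (∏ k, (b k)! : ℕ) * gaussianCoeff μ c E b a := by
  intro b a j _
  dsimp only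
  have hlower (i : ι) : (∏ k, (b k)! : ℕ) * (if b i ≠ 0 then
      gaussianCoeff μ c E (b - Pi.single i 1) a else 0) =
      b i * ((∏ k, ((b - Pi.single i 1 : ι → ℕ) k)! : ℕ) *
        gaussianCoeff μ c E (b - Pi.single i 1) a) := by
    split_ifs with hi
    · rw [← mul_assoc, ← Nat.cast_mul, mul_prod_factorial_sub_single hi]
    · rw [not_not.1 hi, mul_zero, Nat.cast_zero, zero_mul]
  rw [prod_factorial_add_single, Nat.cast_mul, mul_assoc, succ_mul_gaussianCoeff]
  simp only [← hlower, mul_add, Finset.mul_sum, Finset.sum_add_distrib]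
  simp only [mul_left_comm]
  ring

end GaussianBlocks

section Reindexing

lemma prod_sym2_eq_diag_mul {ι M : Type*} [Fintype ι] [LinearOrder ι] [LocallyFiniteOrderTop ι]
    [CommMonoid M] (f : Sym2 ι → M) :
    ∏ s, f s = (∏ i, f s(i, i)) * ∏ i, ∏ j ∈ Finset.Ioi i, f s(i, j) := by
  have hIci (i : ι) : f s(i, i) * ∏ j ∈ Finset.Ioi i, f s(i, j) =
      ∏ j with i ≤ j, f s(i, j) := by
    rw [Finset.filter_le_eq_Ici, ← Finset.Ioi_insert, Finset.prod_insert (by simp)]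
  rw [← Finset.prod_mul_distrib]
  simp only [hIci, Finset.prod_filter]
  rw [← Fintype.prod_prod_type' (f := fun i j => if i ≤ j then f s(i, j) else 1),
    ← Finset.prod_filter, ← Equiv.prod_comp Sym2.sortEquiv.symm]
  exact (Finset.prod_subtype (p := fun p : ι × ι => p.1 ≤ p.2) _
    (fun p => by simp) fun p => f s(p.1, p.2)).symm

lemma prod_prod_eq_diag_mul {ι M : Type*} [Fintype ι] [LinearOrder ι] [LocallyFiniteOrderTop ι]
    [LocallyFiniteOrderBot ι] [CommMonoid M] (f : ι → ι → M) :
    ∏ i, ∏ j, f i j = (∏ i, f i i) * ∏ i, ∏ j ∈ Finset.Ioi i, f i j * f j i := by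
  rw [Finset.prod_prod_Ioi_mul_eq_prod_prod_off_diag fun i j => f j i, ← Finset.prod_mul_distrib]
  exact Finset.prod_congr rfl fun i _ => Fintype.prod_eq_mul_prod_compl i _

variable {N : ℕ}

lemma mem_decompositions {n : Fin N → ℕ} {p : (Fin N → ℕ) × (Fin N → Fin N → ℕ)} :
    p ∈ decompositions n ↔ ∀ i, p.1 i + ∑ j, p.2 i j = n i := by
  simp only [decompositions, Finset.mem_filter, Finset.mem_product, Fintype.mem_piFinset,
    Finset.mem_range, and_iff_right_iff_imp]
  refine fun h => ⟨fun i => by have := h i; omega, fun i j => ?_⟩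
  have hle : p.2 i j ≤ ∑ j, p.2 i j :=
    Finset.single_le_sum_of_canonicallyOrdered (Finset.mem_univ j)
  have := h i
  omega

lemma mem_pairings {l k : Fin N → Fin N → ℕ} :
    k ∈ pairings l ↔
      (∀ i j, (1 + if i = j then 1 else 0) * k i j ≤ l i j) ∧ ∀ i j, k i j = k j i := by
  simp only [pairings, Finset.mem_filter, Fintype.mem_piFinset, Finset.mem_range, maxPairing]
  refine and_congr_left fun hsymm => ⟨fun h i j => ?_, fun h i j => ?_⟩
  · have := h i j
    split_ifs at this ⊢ with hij
    · subst hij; omega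
    · omega
  · have hrow := h i j
    have hcol := h j i
    rw [← hsymm i j] at hcol
    rcases eq_or_ne i j with rfl | hij
    · simp only [if_true] at hrow ⊢
      omega
    · simp only [if_neg hij, if_neg hij.symm] at hrow hcol ⊢
      omega

/-- The family `(r, ℓ)` of `decompositions` recorded by the multiplicities of the blocks. A diagonal
contraction `s(i, i)` uses two factors `Xᵢ` and is counted twice in `ℓᵢᵢ`. -/
def decompositionOf (m : BlockIndex (Fin N) → ℕ) : (Fin N → ℕ) × (Fin N → Fin N → ℕ) :=
  (fun i => m (.inl i), fun i j => m (.inr (.inl (i, j))) +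
    (1 + if i = j then 1 else 0) * m (.inr (.inr s(i, j))))

/-- The array `k` of `pairings` recorded by the multiplicities of the blocks. -/
def pairingOf (m : BlockIndex (Fin N) → ℕ) : Fin N → Fin N → ℕ :=
  fun i j => m (.inr (.inr s(i, j)))

/-- The multiplicities of the blocks determined by `(r, ℓ)` and `k`, inverse to `decompositionOf`
and `pairingOf`. The minimum makes the definition symmetric for every `k`; it is `kᵢⱼ` when `k` is
symmetric. -/
def multiplicityOf (p : (Fin N → ℕ) × (Fin N → Fin N → ℕ)) (k : Fin N → Fin N → ℕ) :
    BlockIndex (Fin N) → ℕ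
  | .inl i => p.1 i
  | .inr (.inl q) => p.2 q.1 q.2 - (1 + if q.1 = q.2 then 1 else 0) * k q.1 q.2
  | .inr (.inr s) => Sym2.lift ⟨fun i j => min (k i j) (k j i), fun _ _ => min_comm _ _⟩ s

variable (m : BlockIndex (Fin N) → ℕ)

lemma sum_smul_blockDegree_apply (i : Fin N) :
    (∑ α, m α • blockDegree α) i = (decompositionOf m).1 i + ∑ j, (decompositionOf m).2 i j := by
  simp only [Finset.sum_apply, Pi.smul_apply, smul_eq_mul, Fintype.sum_sum_type,
    decompositionOf, Finset.sum_add_distrib, blockDegree, Fintype.sum_prod_type]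
  congr 1
  · simp [Pi.single_apply]
  congr 1
  · rw [Fintype.sum_eq_single i (fun j hj => by simp [hj.symm])]
    simp
  · rw [sum_sym2_eq_sum_mk i (F := fun s => m (.inr (.inr s)) * pairDegree s i)
      (fun s hs => by rw [pairDegree_of_notMem hs, mul_zero])]
    refine Finset.sum_congr rfl fun j _ => ?_
    simp [pairDegree_mk, Pi.single_apply, mul_comm]

lemma sum_smul_blockShift :
    ∑ α, m α • blockShift α = derivOrder (decompositionOf m).2 (pairingOf m) := by
  ext j
  have horder : derivOrder (decompositionOf m).2 (pairingOf m) j = ∑ i, m (.inr (.inl (i, j))) :=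
    Finset.sum_congr rfl fun i _ => by
      simp [decompositionOf, pairingOf, Sym2.eq_swap (a := j), eq_comm (a := j)]
  rw [horder]
  simp [Fintype.sum_sum_type, Fintype.sum_prod_type, blockShift, Pi.single_apply]

lemma decompositionOf_mem_decompositions {n : Fin N → ℕ}
    (hm : m ∈ weightedMultiplicities blockDegree n) : decompositionOf m ∈ decompositions n := by
  rw [mem_weightedMultiplicities blockDegree_ne_zero] at hm
  exact mem_decompositions.2 fun i => by rw [← sum_smul_blockDegree_apply, hm]

lemma pairingOf_mem_pairings : pairingOf m ∈ pairings (decompositionOf m).2 :=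
  mem_pairings.2 ⟨fun i j => by simp [decompositionOf, pairingOf],
    fun i j => by simp [pairingOf, Sym2.eq_swap (a := i)]⟩

lemma multiplicityOf_decompositionOf_pairingOf :
    multiplicityOf (decompositionOf m) (pairingOf m) = m := by
  ext (i | q | s)
  · rfl
  · simp [multiplicityOf, decompositionOf, pairingOf]
  · induction s using Sym2.ind with
    | _ i j => simp [multiplicityOf, pairingOf, Sym2.eq_swap (a := j)]

section

variable {p : (Fin N → ℕ) × (Fin N → Fin N → ℕ)} {k : Fin N → Fin N → ℕ}

lemma pairingOf_multiplicityOf (hk : k ∈ pairings p.2) : pairingOf (multiplicityOf p k) = k := by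
  ext i j
  simp [pairingOf, multiplicityOf, ← (mem_pairings.1 hk).2 i j]

lemma decompositionOf_multiplicityOf (hk : k ∈ pairings p.2) :
    decompositionOf (multiplicityOf p k) = p := by
  obtain ⟨hle, hsymm⟩ := mem_pairings.1 hk
  refine Prod.ext rfl (funext₂ fun i j => ?_)
  simp only [decompositionOf, multiplicityOf, Sym2.lift_mk, ← hsymm i j, min_self]
  exact Nat.sub_add_cancel (hle i j)

lemma multiplicityOf_mem_weightedMultiplicities {n : Fin N → ℕ} (hp : p ∈ decompositions n)
    (hk : k ∈ pairings p.2) : multiplicityOf p k ∈ weightedMultiplicities blockDegree n := by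
  rw [mem_weightedMultiplicities blockDegree_ne_zero]
  ext i
  rw [sum_smul_blockDegree_apply, decompositionOf_multiplicityOf hk, mem_decompositions.1 hp]

end

theorem sum_weightedMultiplicities_blockDegree {M : Type*} [AddCommMonoid M] (n : Fin N → ℕ)
    (f : (Fin N → ℕ) × (Fin N → Fin N → ℕ) → (Fin N → Fin N → ℕ) → M) :
    ∑ m ∈ weightedMultiplicities blockDegree n, f (decompositionOf m) (pairingOf m) =
      ∑ p ∈ decompositions n, ∑ k ∈ pairings p.2, f p k := by
  rw [Finset.sum_sigma']
  refine Finset.sum_nbij' (fun m => ⟨decompositionOf m, pairingOf m⟩)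
    (fun q => multiplicityOf q.1 q.2) (fun m hm => ?_) (fun q hq => ?_)
    (fun m _ => multiplicityOf_decompositionOf_pairingOf m) (fun q hq => ?_) fun _ _ => rfl
  · exact Finset.mem_sigma.2 ⟨decompositionOf_mem_decompositions m hm, pairingOf_mem_pairings m⟩
  · obtain ⟨hp, hk⟩ := Finset.mem_sigma.1 hq
    exact multiplicityOf_mem_weightedMultiplicities hp hk
  · have hk := (Finset.mem_sigma.1 hq).2
    simp only [decompositionOf_multiplicityOf hk, pairingOf_multiplicityOf hk]

lemma coeffH_div_factorial (x : ℝ) (p k : ℕ) :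
    coeffH (p + 2 * k) k * x ^ (p + 2 * k - k) / (p + 2 * k)! =
      x ^ p / p ! * ((x / 2) ^ k / k !) := by
  have hsub : p + 2 * k - 2 * k = p := by omega
  have hexp : p + 2 * k - k = p + k := by omega
  rw [coeffH, hsub, hexp, div_pow, pow_add]
  field_simp

lemma coeffG_div_factorial (x : ℝ) (p q k : ℕ) :
    coeffG (p + k) (q + k) k * x ^ (p + k + (q + k) - k) / ((p + k)! * (q + k)!) =
      x ^ p / p ! * (x ^ q / q !) * (x ^ k / k !) := by
  have hexp : p + k + (q + k) - k = p + q + k := by omega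
  rw [coeffG, hexp, pow_add, pow_add, ← Nat.choose_symm_add, ← Nat.choose_symm_add,
    Nat.cast_add_choose, Nat.cast_add_choose]
  field_simp

section

variable (μ : Fin N → ℝ) (c : Sym2 (Fin N) → ℝ)

lemma coeffH_decompositionOf (i : Fin N) :
    coeffH ((decompositionOf m).2 i i) (pairingOf m i i) *
        c s(i, i) ^ ((decompositionOf m).2 i i - pairingOf m i i) / ((decompositionOf m).2 i i)! =
      c s(i, i) ^ m (.inr (.inl (i, i))) / (m (.inr (.inl (i, i))))! *
        (pairWeight c s(i, i) ^ m (.inr (.inr s(i, i))) / (m (.inr (.inr s(i, i))))!) := by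
  have hl : (decompositionOf m).2 i i = m (.inr (.inl (i, i))) + 2 * pairingOf m i i := by
    simp [decompositionOf, pairingOf]
  have hw : pairWeight c s(i, i) = c s(i, i) / 2 := if_pos rfl
  rw [hl, hw]
  exact coeffH_div_factorial _ _ _

lemma coeffG_decompositionOf {i j : Fin N} (hij : i ≠ j) :
    coeffG ((decompositionOf m).2 i j) ((decompositionOf m).2 j i) (pairingOf m i j) *
        c s(i, j) ^ ((decompositionOf m).2 i j + (decompositionOf m).2 j i - pairingOf m i j) /
          (((decompositionOf m).2 i j)! * ((decompositionOf m).2 j i)!) =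
      c s(i, j) ^ m (.inr (.inl (i, j))) / (m (.inr (.inl (i, j))))! *
        (c s(j, i) ^ m (.inr (.inl (j, i))) / (m (.inr (.inl (j, i))))!) *
        (pairWeight c s(i, j) ^ m (.inr (.inr s(i, j))) / (m (.inr (.inr s(i, j))))!) := by
  have hrow : (decompositionOf m).2 i j = m (.inr (.inl (i, j))) + pairingOf m i j := by
    simp [decompositionOf, pairingOf, hij]
  have hcol : (decompositionOf m).2 j i = m (.inr (.inl (j, i))) + pairingOf m i j := by
    simp [decompositionOf, pairingOf, hij.symm, Sym2.eq_swap (a := j)]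
  have hw : pairWeight c s(i, j) = c s(i, j) := if_neg hij
  rw [hrow, hcol, hw, Sym2.eq_swap (a := j)]
  exact coeffG_div_factorial _ _ _ _

lemma dividedMonomial_blockWeight :
    dividedMonomial (blockWeight μ c) m =
      (∏ i, μ i ^ (decompositionOf m).1 i / ((decompositionOf m).1 i)!) *
      ((∏ i, coeffH ((decompositionOf m).2 i i) (pairingOf m i i) *
        c s(i, i) ^ ((decompositionOf m).2 i i - pairingOf m i i) / ((decompositionOf m).2 i i)!) *
      ∏ i, ∏ j ∈ Finset.Ioi i,
        coeffG ((decompositionOf m).2 i j) ((decompositionOf m).2 j i) (pairingOf m i j) *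
        c s(i, j) ^ ((decompositionOf m).2 i j + (decompositionOf m).2 j i - pairingOf m i j) /
          (((decompositionOf m).2 i j)! * ((decompositionOf m).2 j i)!)) := by
  have hoff (i : Fin N) := Finset.prod_congr rfl fun j hj =>
    coeffG_decompositionOf m c (Finset.mem_Ioi.1 hj : i < j).ne
  simp only [hoff, coeffH_decompositionOf, Finset.prod_mul_distrib]
  rw [dividedMonomial, Fintype.prod_sum_type, Fintype.prod_sum_type, Fintype.prod_prod_type,
    prod_prod_eq_diag_mul, prod_sym2_eq_diag_mul]
  simp only [blockWeight, Finset.prod_mul_distrib, decompositionOf]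
  ring

end

lemma prod_multinomialCoeff (n r : Fin N → ℕ) (l : Fin N → Fin N → ℕ) :
    ∏ i, multinomialCoeff (n i) (r i) (l i) = (∏ i, (n i)! : ℕ) / ((∏ i, ((r i)! : ℝ)) *
      ((∏ i, ((l i i)! : ℝ)) * ∏ i, ∏ j ∈ Finset.Ioi i, ((l i j)! * (l j i)! : ℝ))) := by
  rw [← prod_prod_eq_diag_mul fun i j => ((l i j)! : ℝ), Nat.cast_prod, ← Finset.prod_mul_distrib,
    ← Finset.prod_div_distrib]
  rfl

theorem prod_factorial_mul_dividedMonomial_blockWeight (μ : Fin N → ℝ) (c : Sym2 (Fin N) → ℝ)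
    (n : Fin N → ℕ) :
    (∏ i, (n i)! : ℕ) * dividedMonomial (blockWeight μ c) m =
      (∏ i, multinomialCoeff (n i) ((decompositionOf m).1 i) ((decompositionOf m).2 i)) *
      (∏ i, μ i ^ (decompositionOf m).1 i) *
      ((∏ i, coeffH ((decompositionOf m).2 i i) (pairingOf m i i) *
        c s(i, i) ^ ((decompositionOf m).2 i i - pairingOf m i i)) *
      ∏ i, ∏ j ∈ Finset.Ioi i,
        coeffG ((decompositionOf m).2 i j) ((decompositionOf m).2 j i) (pairingOf m i j) *
        c s(i, j) ^ ((decompositionOf m).2 i j + (decompositionOf m).2 j i - pairingOf m i j)) := by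
  rw [dividedMonomial_blockWeight, prod_multinomialCoeff]
  simp only [Finset.prod_div_distrib]
  ring

theorem prod_factorial_mul_gaussianCoeff_zero (μ : Fin N → ℝ) (c : Sym2 (Fin N) → ℝ)
    (E : (Fin N → ℕ) → ℝ) (n : Fin N → ℕ) :
    (∏ i, (n i)! : ℕ) * gaussianCoeff μ c E n 0 =
      ∑ p ∈ decompositions n,
        (∏ i, multinomialCoeff (n i) (p.1 i) (p.2 i)) * (∏ i, μ i ^ p.1 i) *
          ∑ k ∈ pairings p.2,
            (∏ i, coeffH (p.2 i i) (k i i) * c s(i, i) ^ (p.2 i i - k i i)) *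
            (∏ i, ∏ j ∈ Finset.Ioi i, coeffG (p.2 i j) (p.2 j i) (k i j) *
              c s(i, j) ^ (p.2 i j + p.2 j i - k i j)) *
            E (derivOrder p.2 k) := by
  simp only [Finset.mul_sum]
  rw [← sum_weightedMultiplicities_blockDegree n, gaussianCoeff, exponentialCoeff, Finset.mul_sum]
  refine Finset.sum_congr rfl fun m _ => ?_
  rw [← mul_assoc, prod_factorial_mul_dividedMonomial_blockWeight, zero_add, sum_smul_blockShift,
    mul_assoc]

end Reindexing

section MomentFormula

variable {Ω : Type*} {mΩ : MeasurableSpace Ω} {P : Measure Ω} {N : ℕ} {X : Ω → Fin N → ℝ}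
  {g : (Fin N → ℝ) → ℝ} {n : Fin N → ℕ}

lemma integrable_mixedPartial_of_le
    (hint : ∀ p ∈ decompositions n, ∀ k ∈ pairings p.2,
      Integrable (fun ω => mixedPartial (derivOrder p.2 k) g (X ω)) P)
    {a : Fin N → ℕ} (ha : ∑ i, a i ≤ ∑ i, n i) :
    Integrable (fun ω => mixedPartial a g (X ω)) P := by
  obtain ⟨l, hrow, hcol⟩ := exists_matrix_of_sum_le ha
  have hdecomp : (fun i => n i - ∑ j, l i j, l) ∈ decompositions n :=
    mem_decompositions.2 fun i => Nat.sub_add_cancel (hrow i)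
  have hzero : (0 : Fin N → Fin N → ℕ) ∈ pairings l := mem_pairings.2 (by simp)
  have horder : derivOrder l 0 = a := by
    ext i
    simp [derivOrder, hcol]
  exact horder ▸ hint _ hdecomp 0 hzero

theorem integral_prod_pow_mul_comp (hX : HasGaussianLaw X P)
    {c : Sym2 (Fin N) → ℝ} (hc : ∀ i j, cov[fun ω => X ω i, fun ω => X ω j; P] = c s(i, j))
    (hg : ContDiff ℝ (∑ i, n i : ℕ) g)
    (hint : ∀ a : Fin N → ℕ, ∑ i, a i ≤ ∑ i, n i →
      Integrable (fun ω => mixedPartial a g (X ω)) P) :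
    ∫ ω, (∏ i, X ω i ^ n i) * g (X ω) ∂P = (∏ i, (n i)! : ℕ) *
      gaussianCoeff (fun i => ∫ ω, X ω i ∂P) c (fun a => ∫ ω, mixedPartial a g (X ω) ∂P) n 0 := by
  have hrec := steinRecursion_integral hX hg hint
  simp only [hc] at hrec
  have heq := hrec.eq (steinRecursion_gaussianCoeff _ c
    (fun a => ∫ ω, mixedPartial a g (X ω) ∂P) (∑ i, n i))
    (fun a _ => by simp [gaussianCoeff, exponentialCoeff_zero blockDegree_ne_zero]) n 0 (by simp)
  simpa only [mixedPartial_zero] using heq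

end MomentFormula

end GaussianFormula

theorem theorem2 {Ω : Type*} [MeasurableSpace Ω] (P : Measure Ω) [IsProbabilityMeasure P]
    (N : ℕ) (X : Ω → (Fin N → ℝ)) (hX : HasGaussianLaw X P)
    (μ : Fin N → ℝ) (hμ : ∀ i, ∫ ω, X ω i ∂P = μ i)
    (C : Matrix (Fin N) (Fin N) ℝ)
    (hC : ∀ i j, covariance (fun ω => X ω i) (fun ω => X ω j) P = C i j)
    (n : Fin N → ℕ)
    (g : (Fin N → ℝ) → ℝ) (hg : ContDiff ℝ (∑ i, n i : ℕ) g)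
    (hint : Integrable (fun ω => g (X ω) * ∏ i, X ω i ^ n i) P)
    (hint' : ∀ p ∈ decompositions n, ∀ k ∈ pairings p.2,
      Integrable (fun ω => mixedPartial (derivOrder p.2 k) g (X ω)) P) :
    ∫ ω, g (X ω) * ∏ i, X ω i ^ n i ∂P =
      ∑ p ∈ decompositions n,
        (∏ i, multinomialCoeff (n i) (p.1 i) (p.2 i)) * (∏ i, μ i ^ p.1 i) *
          ∑ k ∈ pairings p.2,
            (∏ i, coeffH (p.2 i i) (k i i) * C i i ^ (p.2 i i - k i i)) *
            (∏ i, ∏ j ∈ Finset.Ioi i,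
              coeffG (p.2 i j) (p.2 j i) (k i j) * C i j ^ (p.2 i j + p.2 j i - k i j)) *
            ∫ ω, mixedPartial (derivOrder p.2 k) g (X ω) ∂P := by
  obtain rfl : (fun i => ∫ ω, X ω i ∂P) = μ := funext hμ
  have hsymm (i j : Fin N) : C i j = C j i := by rw [← hC, ← hC, covariance_comm]
  simp only [mul_comm (g _)]
  rw [integral_prod_pow_mul_comp (c := Sym2.lift ⟨C, hsymm⟩) hX hC hg fun a ha =>
    integrable_mixedPartial_of_le hint' ha, prod_factorial_mul_gaussianCoeff_zero]
  rfl
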